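/- Let $\Sigma,\Gamma$ be finite alphabets, $\mathcal D$ a countably infinite set of data and $\mathsf d_0\in\mathcal D$. A non-deterministic register transducer (NRT) is a tuple $T=(Q,R,i_0,F,\Delta)$ with finite sets $Q$ of states and $R$ of registers, an initial state $i_0\in Q$, accepting states $F\subseteq Q$, and a finite set $\Delta\subseteq Q\times\Sigma\times \mathrm{Tst}_R\times 2^R\times(\Gamma\times R)^*\times Q$ of transitions, where $\mathrm{Tst}_R$ is the set of Boolean formulas (built with $\top,\bot,\wedge,\vee,\neg$) over the atoms $r^=$ and $r^{\neq}$, $r\in R$; for a valuation $\tau:R\to\mathcal D$ and $d\in\mathcal D$, $\tau,d\models r^=$ means $\tau(r)=d$ and $\tau,d\models r^{\neq}$ means $\tau(r)\neq d$. From a configuration $(q,\tau)\in Q\times\mathcal D^R$, upon reading $(\sigma,d)\in\Sigma\times\mathcal D$, $T$ may take a transition $(q,\sigma,\phi,\mathsf{asgn},o,q')\in\Delta$ such that $\tau,d\models\phi$. It then moves to $(q',\tau')$, where $\tau'(r)=d$ if $r\in\mathsf{asgn}$ and $\tau'(r)=\tau(r)$ otherwise, and it outputs the finite word $(\gamma_1,\tau'(r_1))\cdots(\gamma_m,\tau'(r_m))$,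 where $o=(\gamma_1,r_1)\cdots(\gamma_m,r_m)$. A run is an infinite sequence of such steps; it is accepting if it starts in state $i_0$ with all registers containing $\mathsf d_0$ and some state of $F$ occurs in it infinitely often. The relation $[\![T]\!]\subseteq(\Sigma\times\mathcal D)^\omega\times(\Gamma\times\mathcal D)^\omega$ is the set of pairs $(u,v)$ of infinite words such that some accepting run of $T$ reads $u$ and the concatenation of its outputs is $v$. A relation $S$ is functional if $(x,y),(x,z)\in S$ implies $y=z$, and $T$ is functional if $[\![T]\!]$ is. **Theorem.** Let $T$ be an NRT with $k$ registers. Then, for every $X\subseteq\mathcal D$ (finite or infinite) of size $|X|\ge 2k+3$ with $\mathsf d_0\in X$, $T$ is functional if and only if the relation $$[\![T]\!]\cap\bigl((\Sigma\times X)^\omega\times(\Gamma\times X)^\omega\bigr)$$ is functional. -/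

import Mathlib

/-- Symbolic tests over a set `R` of registers. -/
inductive RegTest (R : Type*) where
  | top : RegTest R
  | bot : RegTest R
  | eq (r : R) : RegTest R
  | ne (r : R) : RegTest R
  | and (φ ψ : RegTest R) : RegTest R
  | or (φ ψ : RegTest R) : RegTest R
  | not (φ : RegTest R) : RegTest R

/-- `φ.Sat τ d` : the data `d` satisfies the test `φ` in the valuation `τ` of the registers. -/
def RegTest.Sat {R D : Type*} (τ : R → D) (d : D) : RegTest R → Prop
  | .top => True
  | .bot => False
  | .eq r => τ r = d
  | .ne r => τ r ≠ d
  | .and φ ψ => φ.Sat τ d ∧ ψ.Sat τ d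
  | .or φ ψ => φ.Sat τ d ∨ ψ.Sat τ d
  | .not φ => ¬ φ.Sat τ d

/-- A transition `q --(σ, φ | asgn, o)--> q'` with input labels in `A`, output labels in `B`,
states in `Q` and registers in `R`. -/
structure RegTransition (A B Q R : Type*) where
  source : Q
  label : A
  test : RegTest R
  asgn : Set R
  out : List (B × R)
  target : Q

/-- Non-deterministic register transducers with input labels in `A`, output labels in `B`,
finite set of states `Q` and finite set of registers `R`. -/
structure NRT (A B Q R : Type*) where
  finite_states : Finite Q
  finite_registers : Finite R
  init : Q
  accept : Set Q
  trans : Set (RegTransition A B Q R)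
  finite_trans : trans.Finite

/-- Infinite data words: infinite sequences of labelled data. -/
abbrev DataWord (A D : Type*) := ℕ → A × D

/-- The data words all of whose data belong to `X`. -/
def dataWordsOver (A : Type*) {D : Type*} (X : Set D) : Set (DataWord A D) :=
  {w | ∀ n, (w n).2 ∈ X}

/-- A relation is functional if it relates every element to at most one element. -/
def IsFunctionalRel {α β : Type*} (S : Set (α × β)) : Prop :=
  ∀ x y z, (x, y) ∈ S → (x, z) ∈ S → y = z

/-- The finite word `v 0 · v 1 ⋯ v (n - 1)`. -/
def concatPrefix {α : Type*} (v : ℕ → List α) (n : ℕ) : List α :=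
  ((List.range n).map v).flatten

/-- The concatenation `v 0 · v 1 · v 2 ⋯` is infinite and equal to the infinite word `w`. -/
def IsInfiniteConcat {α : Type*} (v : ℕ → List α) (w : ℕ → α) : Prop :=
  (∀ n, concatPrefix v n = (List.range (concatPrefix v n).length).map w) ∧
    ∀ m, ∃ n, m ≤ (concatPrefix v n).length

namespace NRT

variable {A B Q R : Type*}

/-- The labelled transition system of `T` on configurations `(q, τ)`, with labels `(l, w)` where
`l` is the labelled data that is read and `w` the finite data word that is produced. Outputs are
evaluated in the updated valuation. -/
def Step {D : Type*} (T : NRT A B Q R) (c : Q × (R → D)) (l : A × D) (w : List (B × D))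
    (c' : Q × (R → D)) : Prop :=
  ∃ t ∈ T.trans,
    t.source = c.1 ∧ t.target = c'.1 ∧
    t.label = l.1 ∧
    t.test.Sat c.2 l.2 ∧
    (∀ r ∈ t.asgn, c'.2 r = l.2) ∧ (∀ r ∉ t.asgn, c'.2 r = c.2 r) ∧
    w = t.out.map (fun p => (p.1, c'.2 p.2))

/-- (Infinite) runs of `T` over the data `D`. -/
structure Run (T : NRT A B Q R) (D : Type*) where
  config : ℕ → Q × (R → D)
  input : DataWord A D
  output : ℕ → List (B × D)
  step : ∀ n, T.Step (config n) (input n) (output n) (config (n + 1))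

/-- The run starts in the initial state with all registers containing `d₀`. -/
def Run.IsInitial {T : NRT A B Q R} {D : Type*} (d₀ : D) (ρ : T.Run D) : Prop :=
  ρ.config 0 = (T.init, fun _ => d₀)

/-- The states that occur infinitely often in a run. -/
def Run.inf {T : NRT A B Q R} {D : Type*} (ρ : T.Run D) : Set Q :=
  {q | ∃ᶠ n in Filter.atTop, (ρ.config n).1 = q}

/-- The Büchi condition. -/
def Run.IsFinal {T : NRT A B Q R} {D : Type*} (ρ : T.Run D) : Prop :=
  (ρ.inf ∩ T.accept).Nonempty

/-- Accepting runs are the initial and final ones. -/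
def Run.IsAccepting {T : NRT A B Q R} {D : Type*} (d₀ : D) (ρ : T.Run D) : Prop :=
  ρ.IsInitial d₀ ∧ ρ.IsFinal

/-- The relation between infinite data words represented by `T`. -/
def rel {D : Type*} (T : NRT A B Q R) (d₀ : D) : Set (DataWord A D × DataWord B D) :=
  {p | ∃ ρ : T.Run D, ρ.IsAccepting d₀ ∧ ρ.input = p.1 ∧ IsInfiniteConcat ρ.output p.2}

/-- `T` is functional if the relation it represents is. -/
def IsFunctional {D : Type*} (T : NRT A B Q R) (d₀ : D) : Prop :=
  IsFunctionalRel (T.rel d₀)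

end NRT

/-! Suppose two accepting runs on the same input have outputs that differ at position `m`. A
transducer only tests equality between the datum read and its registers, so a step survives any
renaming of data that is injective on those values. The renaming may therefore change with time,
provided consecutive maps agree on the current register contents. Both runs are renamed into `X` by
the same maps, which are kept injective on the registers of both runs together with one protected
datum, that of `y m`: at most `2k + 1` values, so `X` always has a fresh image for the datum read.
The two runs may emit their `m`-th letters at different times. Since the image of the protected
datum never changes, the renamed letters still differ, contradicting functionality over `X`. -/

/-- An injection of a set into `X` extends to one more point if `X` is large enough. -/
theorem exists_injOn_insert_extension {D : Type*} {X L : Set D}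
    (hX : L.encard < X.encard) (d : D) {f : D → D} (hf : Set.MapsTo f L X)
    (hinj : Set.InjOn f L) :
    ∃ g : D → D, Set.MapsTo g (insert d L) X ∧ Set.InjOn g (insert d L) ∧ Set.EqOn g f L := by
  classical
  by_cases hd : d ∈ L
  · exact ⟨f, by rwa [Set.insert_eq_of_mem hd], by rwa [Set.insert_eq_of_mem hd], fun _ _ => rfl⟩
  have hlt : (f '' L).encard < X.encard := (Set.encard_image_le f L).trans_lt hX
  obtain ⟨x, hxX, hx⟩ : ∃ x ∈ X, x ∉ f '' L := by
    by_contra! h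
    exact absurd (Set.encard_le_encard (show X ⊆ f '' L from h)) (not_le.mpr hlt)
  have heq : Set.EqOn (Function.update f d x) f L := fun a ha =>
    Function.update_of_ne (ne_of_mem_of_not_mem ha hd) _ _
  refine ⟨Function.update f d x, ?_, ?_, heq⟩
  · rintro a (rfl | ha)
    · simpa using hxX
    · rw [heq ha]
      exact hf ha
  · rw [Set.injOn_insert hd]
    refine ⟨hinj.congr heq.symm, ?_⟩
    rw [heq.image_eq, Function.update_self]
    exact hx

/-- A sequence of sets growing by at most one new point at a time can be mapped injectively into a
sufficiently large set `X`, coherently along the sequence. -/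
theorem exists_coherent_injOn {D : Type*} {X : Set D} (L : ℕ → Set D) (d : ℕ → D)
    (hX : ∀ n, (L n).encard < X.encard)
    (hL : ∀ n, L (n + 1) ⊆ insert (d n) (L n)) {f₀ : D → D}
    (hf₀ : Set.MapsTo f₀ (L 0) X) (hinj₀ : Set.InjOn f₀ (L 0)) :
    ∃ f : ℕ → D → D, f 0 = f₀ ∧ ∀ n, Set.MapsTo (f (n + 1)) (insert (d n) (L n)) X ∧
      Set.InjOn (f (n + 1)) (insert (d n) (L n)) ∧ Set.EqOn (f (n + 1)) (f n) (L n) := by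
  choose g hg using fun (n : ℕ) (f : {f : D → D // Set.MapsTo f (L n) X ∧ Set.InjOn f (L n)}) =>
    exists_injOn_insert_extension (hX n) (d n) f.2.1 f.2.2
  let F : ∀ n, {f : D → D // Set.MapsTo f (L n) X ∧ Set.InjOn f (L n)} := fun n =>
    Nat.rec ⟨f₀, hf₀, hinj₀⟩
      (fun n f => ⟨g n f, (hg n f).1.mono_left (hL n), (hg n f).2.1.mono (hL n)⟩) n
  exact ⟨fun n => (F n).1, rfl, fun n => hg n (F n)⟩

theorem concatPrefix_succ {α : Type*} (v : ℕ → List α) (n : ℕ) :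
    concatPrefix v (n + 1) = concatPrefix v n ++ v n := by
  simp [concatPrefix, List.range_succ]

theorem length_concatPrefix_map {α β : Type*} (v : ℕ → List α) (g : ℕ → α → β) (n : ℕ) :
    (concatPrefix (fun n => (v n).map (g n)) n).length = (concatPrefix v n).length := by
  induction n with
  | zero => rfl
  | succ n ih => simp [concatPrefix_succ, ih]

/-- Letters of an infinite concatenation can be renamed factor by factor. -/
theorem IsInfiniteConcat.exists_map {α β : Type*} {v : ℕ → List α} {w : ℕ → α}
    (h : IsInfiniteConcat v w) (g : ℕ → α → β) :
    ∃ w' : ℕ → β, IsInfiniteConcat (fun n => (v n).map (g n)) w' ∧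
      ∀ m, ∃ n, w m ∈ v n ∧ w' m = g n (w m) := by
  have hpos : ∀ m, ∃ n, (concatPrefix v n).length ≤ m ∧ m < (concatPrefix v (n + 1)).length := by
    intro m
    classical
    have hex : ∃ n, m < (concatPrefix v n).length := h.2 (m + 1)
    obtain ⟨n, hn⟩ : ∃ n, Nat.find hex = n + 1 := by
      refine Nat.exists_eq_succ_of_ne_zero fun h0 => ?_
      have := Nat.find_spec hex
      rw [h0] at this
      simp [concatPrefix] at this
    exact ⟨n, not_lt.mp (Nat.find_min hex (by omega)), hn ▸ Nat.find_spec hex⟩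
  have hmono : Monotone fun n => (concatPrefix v n).length :=
    monotone_nat_of_le_succ fun n => by simp [concatPrefix_succ]
  choose N hN₁ hN₂ using hpos
  -- Uniqueness of the factor containing a position ensures that every letter of factor `n` is
  -- renamed by `g n`; empty factors contain no position.
  have hN : ∀ n m, (concatPrefix v n).length ≤ m → m < (concatPrefix v (n + 1)).length →
      N m = n := by
    intro n m h₁ h₂
    rcases lt_trichotomy (N m) n with hlt | heq | hgt
    · exact absurd (hmono (show N m + 1 ≤ n from hlt)) (by have := hN₂ m; simp only; omega)
    · exact heq
    · exact absurd (hmono (show n + 1 ≤ N m from hgt)) (by have := hN₁ m; simp only; omega)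
  have hfac : ∀ n, v n = (List.range (v n).length).map
      fun i => w ((concatPrefix v n).length + i) := by
    intro n
    have h₁ := h.1 (n + 1)
    rw [concatPrefix_succ, List.length_append, List.range_add, List.map_append, ← h.1 n,
      List.append_cancel_left_eq, List.map_map] at h₁
    exact h₁
  refine ⟨fun m => g (N m) (w m), ⟨fun n => ?_, fun m => ?_⟩, fun m => ⟨N m, ?_, rfl⟩⟩
  · rw [length_concatPrefix_map]
    induction n with
    | zero => rfl
    | succ n ih =>
      rw [concatPrefix_succ, ih, concatPrefix_succ, List.length_append, List.range_add,
        List.map_append, List.append_cancel_left_eq]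
      conv_lhs => rw [hfac n]
      rw [List.map_map, List.map_map]
      refine List.map_congr_left fun i hi => ?_
      have hi' := List.mem_range.mp hi
      simp only [Function.comp]
      rw [hN n _ (by omega) (by rw [concatPrefix_succ, List.length_append]; omega)]
  · obtain ⟨n, hn⟩ := h.2 m
    exact ⟨n, by rwa [length_concatPrefix_map]⟩
  · rw [hfac (N m), List.mem_map]
    have h₂ := hN₂ m
    rw [concatPrefix_succ, List.length_append] at h₂
    exact ⟨m - (concatPrefix v (N m)).length, List.mem_range.mpr (by have := hN₁ m; omega),
      congrArg w (by have := hN₁ m; omega)⟩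

/-- Tests are invariant under renamings injective on the data involved. -/
theorem RegTest.sat_comp_iff {R D E : Type*} {f : D → E} {τ : R → D} {d : D}
    (hf : Set.InjOn f (insert d (Set.range τ))) (φ : RegTest R) :
    φ.Sat (f ∘ τ) (f d) ↔ φ.Sat τ d := by
  have key : ∀ r, f (τ r) = f d ↔ τ r = d := fun r =>
    hf.eq_iff (Or.inr ⟨r, rfl⟩) (Or.inl rfl)
  induction φ with
  | top => rfl
  | bot => rfl
  | eq r => exact key r
  | ne r => exact not_congr (key r)
  | and φ ψ h₁ h₂ => exact and_congr h₁ h₂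
  | or φ ψ h₁ h₂ => exact or_congr h₁ h₂
  | not φ h => exact not_congr h

namespace NRT

variable {A B Q R D : Type*}

theorem Step.valuation_mem {T : NRT A B Q R} {c c' : Q × (R → D)} {l : A × D}
    {w : List (B × D)} (h : T.Step c l w c') (r : R) :
    c'.2 r ∈ insert l.2 (Set.range c.2) := by
  obtain ⟨t, -, -, -, -, -, h₁, h₂, -⟩ := h
  by_cases hr : r ∈ t.asgn
  · exact Or.inl (h₁ r hr)
  · exact Or.inr ⟨r, (h₂ r hr).symm⟩

theorem Step.output_mem {T : NRT A B Q R} {c c' : Q × (R → D)} {l : A × D}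
    {w : List (B × D)} (h : T.Step c l w c') {p : B × D} (hp : p ∈ w) :
    p.2 ∈ Set.range c'.2 := by
  obtain ⟨t, -, -, -, -, -, -, -, rfl⟩ := h
  obtain ⟨q, -, rfl⟩ := List.mem_map.mp hp
  exact ⟨q.2, rfl⟩

/-- Steps are preserved by renamings injective on the data involved. -/
theorem Step.rename {E : Type*} {T : NRT A B Q R} {c c' : Q × (R → D)} {l : A × D}
    {w : List (B × D)} (h : T.Step c l w c') {f : D → E}
    (hf : Set.InjOn f (insert l.2 (Set.range c.2))) :
    T.Step (c.1, f ∘ c.2) (l.1, f l.2) (w.map (Prod.map id f)) (c'.1, f ∘ c'.2) := by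
  obtain ⟨t, ht, hs, hg, hl, hsat, h₁, h₂, rfl⟩ := h
  refine ⟨t, ht, hs, hg, hl, (RegTest.sat_comp_iff hf _).mpr hsat, fun r hr => ?_,
    fun r hr => ?_, ?_⟩
  · exact congrArg f (h₁ r hr)
  · exact congrArg f (h₂ r hr)
  · simp

/-- A run is renamed by a sequence of maps coherent along the valuations of the run. -/
def Run.rename {E : Type*} {T : NRT A B Q R} (ρ : T.Run D) (f : ℕ → D → E)
    (hinj : ∀ n, Set.InjOn (f (n + 1)) (insert (ρ.input n).2 (Set.range (ρ.config n).2)))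
    (heq : ∀ n, Set.EqOn (f (n + 1)) (f n) (Set.range (ρ.config n).2)) : T.Run E where
  config n := ((ρ.config n).1, f n ∘ (ρ.config n).2)
  input n := ((ρ.input n).1, f (n + 1) (ρ.input n).2)
  output n := (ρ.output n).map (Prod.map id (f (n + 1)))
  step n := by
    -- Renaming a step needs a single map for both configurations and the datum read; by coherence
    -- `f (n + 1)` also serves for the old valuation.
    have hc : f n ∘ (ρ.config n).2 = f (n + 1) ∘ (ρ.config n).2 :=
      funext fun r => (heq n ⟨r, rfl⟩).symm
    rw [hc]
    exact (ρ.step n).rename (hinj n)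

theorem Run.rename_isAccepting {T : NRT A B Q R} {ρ : T.Run D} {d₀ : D} {f : ℕ → D → D}
    {hinj : ∀ n, Set.InjOn (f (n + 1)) (insert (ρ.input n).2 (Set.range (ρ.config n).2))}
    {heq : ∀ n, Set.EqOn (f (n + 1)) (f n) (Set.range (ρ.config n).2)}
    (h : ρ.IsAccepting d₀) (h₀ : f 0 d₀ = d₀) : (ρ.rename f hinj heq).IsAccepting d₀ := by
  -- Renaming leaves the states untouched, so the Büchi condition transfers as is.
  refine ⟨?_, h.2⟩
  have h₁ : ρ.config 0 = (T.init, fun _ => d₀) := h.1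
  change ((ρ.config 0).1, f 0 ∘ (ρ.config 0).2) = _
  rw [h₁]
  exact Prod.ext rfl (funext fun _ => h₀)

end NRT

theorem mainTheorem4 {A B Q R D : Type*} [Finite A] [Finite B] [Countable D] [Infinite D]
    (d₀ : D) (T : NRT A B Q R) (k : ℕ) (hk : Nat.card R = k)
    (X : Set D) (hX : ((2 * k + 3 : ℕ) : ℕ∞) ≤ X.encard) (hd₀ : d₀ ∈ X) :
    T.IsFunctional d₀ ↔
      IsFunctionalRel (T.rel d₀ ∩ (dataWordsOver A X ×ˢ dataWordsOver B X)) := by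
  refine ⟨fun h x y z hy hz => h x y z hy.1 hz.1, fun h => ?_⟩
  rintro x y z ⟨ρ, hρ, hρx, hy⟩ ⟨σ, hσ, hσx, hz⟩
  dsimp only at hρx hσx hy hz
  by_contra hne
  obtain ⟨m, hm⟩ := Function.ne_iff.mp hne
  have := T.finite_registers
  have hcard : ∀ τ : R → D, (Set.range τ).encard ≤ k := by
    intro τ
    rw [← Set.image_univ]
    refine (Set.encard_image_le _ _).trans ?_
    rw [Set.encard_univ, ENat.card_eq_coe_natCard, hk]
  let L : ℕ → Set D := fun n =>
    insert (y m).2 (Set.range (ρ.config n).2 ∪ Set.range (σ.config n).2)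
  have hρL : ∀ n, Set.range (ρ.config n).2 ⊆ L n := fun n _ ha => Or.inr (Or.inl ha)
  have hσL : ∀ n, Set.range (σ.config n).2 ⊆ L n := fun n _ ha => Or.inr (Or.inr ha)
  have hLX : ∀ n, (L n).encard < X.encard := by
    intro n
    have h₁ : (L n).encard ≤ (k : ℕ∞) + k + 1 := (Set.encard_insert_le _ _).trans
      (add_le_add_left ((Set.encard_union_le _ _).trans (add_le_add (hcard _) (hcard _))) 1)
    -- Only `2k + 1 < |X|` is needed here, so the bound `2k + 3` leaves one value to spare.
    refine (h₁.trans_lt ?_).trans_le hX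
    exact_mod_cast (by omega : k + k + 1 < 2 * k + 3)
  have hLsucc : ∀ n, L (n + 1) ⊆ insert (x n).2 (L n) := by
    rintro n a (rfl | ⟨r, rfl⟩ | ⟨r, rfl⟩)
    · exact Or.inr (Or.inl rfl)
    · have := (ρ.step n).valuation_mem r
      rw [hρx] at this
      exact Set.insert_subset_insert (hρL n) this
    · have := (σ.step n).valuation_mem r
      rw [hσx] at this
      exact Set.insert_subset_insert (hσL n) this
  have hX₁ : ({d₀} : Set D).encard < X.encard := by
    rw [Set.encard_singleton]
    refine lt_of_lt_of_le ?_ hX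
    exact_mod_cast (by omega : 1 < 2 * k + 3)
  -- Extending the identity on `{d₀}` keeps the initial valuation fixed, so renamed runs remain
  -- initial; the protected datum gets its permanent image here.
  obtain ⟨f₀, hf₀X, hf₀inj, hf₀⟩ := exists_injOn_insert_extension hX₁
    (y m).2 (f := id) (by simpa [Set.MapsTo] using hd₀) (Set.injOn_id _)
  have hL₀ : L 0 ⊆ {(y m).2, d₀} := by
    have h₁ : ρ.config 0 = (T.init, fun _ => d₀) := hρ.1
    have h₂ : σ.config 0 = (T.init, fun _ => d₀) := hσ.1
    rintro a (rfl | ⟨r, rfl⟩ | ⟨r, rfl⟩)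
    · exact Or.inl rfl
    · exact Or.inr (by rw [h₁]; rfl)
    · exact Or.inr (by rw [h₂]; rfl)
  obtain ⟨f, rfl, hf⟩ := exists_coherent_injOn L (fun n => (x n).2) hLX hLsucc
    (hf₀X.mono_left hL₀) (hf₀inj.mono hL₀)
  have hconst : ∀ n, f n (y m).2 = f 0 (y m).2 := by
    intro n
    induction n with
    | zero => rfl
    | succ n ih => exact ((hf n).2.2 (Or.inl rfl)).trans ih
  have hρinj : ∀ n, Set.InjOn (f (n + 1)) (insert (ρ.input n).2 (Set.range (ρ.config n).2)) :=
    fun n => (hf n).2.1.mono (by rw [hρx]; exact Set.insert_subset_insert (hρL n))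
  have hσinj : ∀ n, Set.InjOn (f (n + 1)) (insert (σ.input n).2 (Set.range (σ.config n).2)) :=
    fun n => (hf n).2.1.mono (by rw [hσx]; exact Set.insert_subset_insert (hσL n))
  have hρeq : ∀ n, Set.EqOn (f (n + 1)) (f n) (Set.range (ρ.config n).2) :=
    fun n => (hf n).2.2.mono (hρL n)
  have hσeq : ∀ n, Set.EqOn (f (n + 1)) (f n) (Set.range (σ.config n).2) :=
    fun n => (hf n).2.2.mono (hσL n)
  obtain ⟨y', hy', hyy'⟩ := hy.exists_map fun n => Prod.map id (f (n + 1))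
  obtain ⟨z', hz', hzz'⟩ := hz.exists_map fun n => Prod.map id (f (n + 1))
  have hmaps : ∀ n, Set.MapsTo (f (n + 1)) (L (n + 1)) X := fun n =>
    (hf n).1.mono_left (hLsucc n)
  let x' : DataWord A D := fun n => ((x n).1, f (n + 1) (x n).2)
  have hx'X : x' ∈ dataWordsOver A X := fun n => (hf n).1 (Or.inl rfl)
  have hy'X : y' ∈ dataWordsOver B X := by
    intro i
    obtain ⟨n, hn, hi⟩ := hyy' i
    rw [hi]
    exact hmaps n (hρL _ ((ρ.step n).output_mem hn))
  have hz'X : z' ∈ dataWordsOver B X := by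
    intro i
    obtain ⟨n, hn, hi⟩ := hzz' i
    rw [hi]
    exact hmaps n (hσL _ ((σ.step n).output_mem hn))
  have hd : f 0 d₀ = d₀ := hf₀ rfl
  have hyz : y' = z' := h x' y' z'
    ⟨⟨ρ.rename f hρinj hρeq, NRT.Run.rename_isAccepting hρ hd,
      by simp only [NRT.Run.rename, hρx, x'], hy'⟩, hx'X, hy'X⟩
    ⟨⟨σ.rename f hσinj hσeq, NRT.Run.rename_isAccepting hσ hd,
      by simp only [NRT.Run.rename, hσx, x'], hz'⟩, hx'X, hz'X⟩
  obtain ⟨i, hi, hyi⟩ := hyy' m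
  obtain ⟨j, hj, hzj⟩ := hzz' m
  have hm' : y' m = z' m := congrFun hyz m
  rw [hyi, hzj, Prod.ext_iff] at hm'
  obtain ⟨hlab, hdat⟩ := hm'
  simp only [Prod.map_fst, Prod.map_snd, id] at hlab hdat
  -- The letters were emitted at steps `i` and `j`. Moving the protected datum from time `i + 1` to
  -- `j + 1` puts both sides under one map, injective on `L (j + 1)`.
  rw [hconst, ← hconst (j + 1)] at hdat
  exact hm (Prod.ext hlab (((hf j).2.1.mono (hLsucc j)) (Or.inl rfl)
    (hσL _ ((σ.step j).output_mem hj)) hdat))
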